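/- Let $\omega=-\tfrac12+\tfrac{\sqrt{3}}{2}i$, let $D=\mathbb{Z}[\omega]=\{a+b\omega : a,b\in\mathbb{Z}\}$ be the ring of Eisenstein integers, and let $N(a+b\omega)=a^2-ab+b^2$. For a prime element $\pi$ of $D$ with $N\pi\neq 3$ and $\alpha\in D$, the cubic residue character $\chi_\pi(\alpha)$ is $0$ if $\pi\mid\alpha$, and otherwise it is the unique element of $\{1,\omega,\omega^2\}$ with $$\alpha^{(N\pi-1)/3}\equiv\chi_\pi(\alpha)\pmod{\pi}.$$ A prime element $\pi$ of $D$ is called primary if $\pi\equiv 2\pmod 3$ in $D$, that is, if $\pi=a+b\omega$ with $a\equiv 2$ and $b\equiv 0\pmod 3$. **Theorem (Second supplement to the Law of Cubic Reciprocity).** Let $\pi$ be a prime element of $D$ with $N\pi\neq 3$. 1. If $\pi=q$ is a (positive) rational prime, then $q=3m-1$ for some integer $m$, and for this $m$ $$\chi_\pi(1-\omega)=\omega^{2m}.$$ 2. If $\pi=a+b\omega$ is primary and non-rational (i.e. $b\neq 0$), then $a=3m-1$ for some integer $m$, and for this $m$ $$\chi_\pi(1-\omega)=\omega^{2m}.$$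 -/

import Mathlib

/-- The ring `D = ℤ[ω]` of Eisenstein integers: elements `a + b ω` with `a = re`, `b = im` integers,
and multiplication determined by `ω ^ 2 = -1 + (-1) ω`, i.e. `1 + ω + ω ^ 2 = 0`. -/
abbrev EisensteinInt : Type := QuadraticAlgebra ℤ (-1) (-1)

namespace EisensteinInt

/-- The cube root of unity `ω`, as an element of `ℤ[ω]`. -/
abbrev ω : EisensteinInt := ⟨0, 1⟩

/-- `ω` as a unit of `ℤ[ω]` (with inverse `ω ^ 2`), so that `ω ^ k` makes sense for every integer
exponent `k`. -/
def ωUnit : EisensteinIntˣ where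
  val := ω
  inv := ω ^ 2
  val_inv := by
    ext <;> simp [pow_two, QuadraticAlgebra.re_one, QuadraticAlgebra.im_one]
  inv_val := by
    ext <;> simp [pow_two, QuadraticAlgebra.re_one, QuadraticAlgebra.im_one]

/-- The norm `N(a + b ω) = a ^ 2 - a b + b ^ 2`. -/
def norm (α : EisensteinInt) : ℤ := α.re ^ 2 - α.re * α.im + α.im ^ 2

/-- The norm above is the product of an element with its conjugate. -/
theorem coe_norm (α : EisensteinInt) : ((norm α : ℤ) : EisensteinInt) = α * star α := by
  ext
  · rw [QuadraticAlgebra.re_intCast]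
    simp [norm]
    ring
  · rw [QuadraticAlgebra.im_intCast]
    simp
    ring

/-- Congruence `α ≡ β (mod γ)` in `ℤ[ω]`: `γ` divides `α - β`. -/
def Congr (γ α β : EisensteinInt) : Prop := γ ∣ α - β

/-- A primary prime of `ℤ[ω]`: a prime element congruent to `2` modulo `3`. -/
def IsPrimary (π : EisensteinInt) : Prop := Prime π ∧ Congr 3 π 2

open Classical in
/-- The cubic residue character `χ_π(α)` (for a prime `π` with `Nπ ≠ 3`): it is `0` if `π ∣ α`;
otherwise it is the element of `{1, ω, ω ^ 2}` that is congruent to `α ^ ((Nπ - 1) / 3)` modulo `π`.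
For such `π` exactly one of these congruences holds when `π ∤ α`, so the last value `0` is
a default that does not occur. -/
noncomputable def cubicChar (π α : EisensteinInt) : EisensteinInt :=
  if π ∣ α then 0
  else if Congr π (α ^ ((norm π - 1) / 3).toNat) 1 then 1
  else if Congr π (α ^ ((norm π - 1) / 3).toNat) ω then ω
  else if Congr π (α ^ ((norm π - 1) / 3).toNat) (ω ^ 2) then ω ^ 2
  else 0

end EisensteinInt

namespace EisensteinInt

-- Norm and divisibility in `ℤ[ω]`.

attribute [local simp] QuadraticAlgebra.re_one QuadraticAlgebra.im_one QuadraticAlgebra.re_ofNat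
  QuadraticAlgebra.im_ofNat QuadraticAlgebra.re_natCast QuadraticAlgebra.im_natCast

/-! For a rational prime `q`, Frobenius gives `(1 - ω)^q ≡ 1 - ω^2 = -ω^2 (1 - ω)`, and `(q^2 - 1)/3
= (q - 1) m`, so the character is `(-ω^2)^m ≡ ω^(2m)`.

For primary `π = (3m - 1) + 3nω` of norm `p = 3k + 1`, let `χ` be the residue character on `ZMod p`.
The Jacobi sum `J(χ, χ)` equals `π`: it has norm `p`, is divisible by `π` and is `2` mod `3`.
Moreover `J = 2 + 3S`, where `S` sums `χ(1 - ζ)` over the `k`-th roots of unity `ζ ≠ 1`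
(`jacobiSum_eq`). Modulo `3` a sum of cube roots of unity is determined by its length and product
(`three_dvd_sum_sub_prod`), and `∏ (1 - ζ) = k = -1/3`. Hence `J` mod `9` determines `χ(3)`, namely
`χ(3)^2 = ω^n`. Finally `(1 - ω)^4 = 9ω^2` and `k ≡ m + n` mod `3` give `χ(1 - ω) = χ(3)^2 ω^(2k) =
ω^(2m)`. -/

theorem norm_mul (α β : EisensteinInt) : norm (α * β) = norm α * norm β := by
  simp [norm]; ring

theorem norm_natCast (n : ℕ) : norm (n : EisensteinInt) = (n : ℤ) ^ 2 := by
  simp [norm]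

theorem four_mul_norm (α : EisensteinInt) :
    4 * norm α = (2 * α.re - α.im) ^ 2 + 3 * α.im ^ 2 := by
  rw [norm]; ring

theorem norm_nonneg (α : EisensteinInt) : 0 ≤ norm α := by
  nlinarith [four_mul_norm α, sq_nonneg (2 * α.re - α.im), sq_nonneg α.im]

theorem norm_eq_zero {α : EisensteinInt} (h : norm α = 0) : α = 0 := by
  have h4 := four_mul_norm α
  have him : α.im = 0 := by
    by_contra hne
    have := pow_pos (abs_pos.mpr hne) 2
    rw [sq_abs] at this
    nlinarith [sq_nonneg (2 * α.re - α.im)]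
  have hre : α.re = 0 := by
    rw [norm, him] at h
    simpa using h
  exact QuadraticAlgebra.ext hre him

instance : NoZeroDivisors EisensteinInt where
  eq_zero_or_eq_zero_of_mul_eq_zero {a b} h := by
    have h0 : norm a * norm b = 0 := by rw [← norm_mul, h]; simp [norm]
    exact (mul_eq_zero.mp h0).imp norm_eq_zero norm_eq_zero

instance : IsDomain EisensteinInt := NoZeroDivisors.to_isDomain _

theorem isUnit_of_norm_eq_one {α : EisensteinInt} (h : norm α = 1) : IsUnit α :=
  IsUnit.of_mul_eq_one (star α) (by rw [← coe_norm, h, Int.cast_one])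

theorem norm_dvd_of_dvd {α β : EisensteinInt} (h : α ∣ β) : norm α ∣ norm β := by
  obtain ⟨γ, rfl⟩ := h
  exact ⟨norm γ, norm_mul α γ⟩

theorem intCast_dvd_iff {n : ℤ} {α : EisensteinInt} :
    (n : EisensteinInt) ∣ α ↔ n ∣ α.re ∧ n ∣ α.im :=
  QuadraticAlgebra.algebraMap_dvd_iff (r := n) (z := α)

theorem three_dvd_iff {α : EisensteinInt} :
    (3 : EisensteinInt) ∣ α ↔ (3 : ℤ) ∣ α.re ∧ (3 : ℤ) ∣ α.im := by
  simpa using intCast_dvd_iff (n := 3) (α := α)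

/-! ### Cube roots of unity and their congruences. -/

theorem omega_sq_add : ω ^ 2 + ω + 1 = 0 := by
  ext <;> simp [pow_two]

theorem omega_pow_three : ω ^ 3 = 1 := by
  linear_combination (ω - 1) * omega_sq_add

theorem omegaUnit_pow_three : ωUnit ^ 3 = 1 := Units.ext (by
  rw [Units.val_pow_eq_pow_val]; exact omega_pow_three)

theorem omegaUnit_zpow_emod (j : ℤ) : ωUnit ^ j = ωUnit ^ (j % 3) := by
  conv_lhs => rw [← Int.emod_add_mul_ediv j 3, zpow_add, zpow_mul]
  rw [show ωUnit ^ (3 : ℤ) = 1 by exact_mod_cast omegaUnit_pow_three, one_zpow, mul_one]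

theorem pow_three_eq_one_iff {v : EisensteinInt} :
    v ^ 3 = 1 ↔ v = 1 ∨ v = ω ∨ v = ω ^ 2 := by
  constructor
  · intro h
    have : (v - 1) * ((v - ω) * (v - ω ^ 2)) = 0 := by
      linear_combination h + (v - 1) * (ω - 1 - v) * omega_sq_add
    rcases mul_eq_zero.mp this with h | h
    · exact .inl (sub_eq_zero.mp h)
    · rcases mul_eq_zero.mp h with h | h
      · exact .inr (.inl (sub_eq_zero.mp h))
      · exact .inr (.inr (sub_eq_zero.mp h))
  · rintro (rfl | rfl | rfl)
    · simp
    · exact omega_pow_three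
    · rw [← pow_mul, mul_comm, pow_mul, omega_pow_three, one_pow]

theorem omegaUnit_zpow_pow_three (j : ℤ) :
    ((ωUnit ^ j : EisensteinIntˣ) : EisensteinInt) ^ 3 = 1 := by
  rw [← Units.val_pow_eq_pow_val, ← zpow_natCast, ← zpow_mul, mul_comm, zpow_mul, zpow_natCast,
    omegaUnit_pow_three, one_zpow, Units.val_one]

theorem mul_star_of_pow_three {v : EisensteinInt} (hv : v ^ 3 = 1) : v * star v = 1 := by
  rcases pow_three_eq_one_iff.mp hv with rfl | rfl | rfl <;> ext <;> simp [pow_two]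

/-- Distinct cube roots of unity differ by an associate of `1 - ω`. -/
theorem norm_sub_of_pow_three {v w : EisensteinInt} (hv : v ^ 3 = 1) (hw : w ^ 3 = 1)
    (h : v ≠ w) : norm (v - w) = 3 := by
  rcases pow_three_eq_one_iff.mp hv with rfl | rfl | rfl <;>
  rcases pow_three_eq_one_iff.mp hw with rfl | rfl | rfl <;>
  first | exact absurd rfl h | simp [norm, pow_two]

/-- Each factor is a multiple of `1 - ω`, and `(1 - ω)^2 = -3ω`. -/
theorem three_dvd_one_sub_mul_one_sub {v w : EisensteinInt} (hv : v ^ 3 = 1) (hw : w ^ 3 = 1) :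
    (3 : EisensteinInt) ∣ (1 - v) * (1 - w) := by
  rw [three_dvd_iff]
  rcases pow_three_eq_one_iff.mp hv with rfl | rfl | rfl <;>
  rcases pow_three_eq_one_iff.mp hw with rfl | rfl | rfl <;> simp [pow_two]

/-- Modulo `3`, sums of cube roots of unity behave like products. -/
theorem three_dvd_sum_sub_prod {ι : Type*} (s : Finset ι) (f : ι → EisensteinInt)
    (hf : ∀ i ∈ s, f i ^ 3 = 1) :
    (3 : EisensteinInt) ∣ ∑ i ∈ s, f i - (s.card - 1) - ∏ i ∈ s, f i := by
  classical
  induction s using Finset.induction_on with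
  | empty => simp
  | insert a s ha ih =>
    rw [Finset.sum_insert ha, Finset.prod_insert ha, Finset.card_insert_of_notMem ha]
    have hs : ∀ i ∈ s, f i ^ 3 = 1 := fun i hi ↦ hf i (Finset.mem_insert_of_mem hi)
    have hp : (∏ i ∈ s, f i) ^ 3 = 1 := by
      rw [← Finset.prod_pow, Finset.prod_congr rfl hs, Finset.prod_const_one]
    have h1 := three_dvd_one_sub_mul_one_sub (hf a (Finset.mem_insert_self a s)) hp
    convert dvd_sub (ih hs) h1 using 1
    push_cast
    ring

/-- Expanding `ω^n = (1 - (1 - ω))^n` to first order gives `(1 - n) + nω` mod `3`, and the three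
cube roots of unity are distinct mod `3`. -/
theorem omegaUnit_zpow_eq {v : EisensteinInt} (hv : v ^ 3 = 1) {n : ℤ}
    (h : (3 : EisensteinInt) ∣ ⟨1 - n, n⟩ - v) :
    v = ((ωUnit ^ n : EisensteinIntˣ) : EisensteinInt) := by
  rw [three_dvd_iff] at h
  rw [omegaUnit_zpow_emod]
  have h1 : ((ωUnit : EisensteinIntˣ) : EisensteinInt) = ω := rfl
  have h3 : n % 3 = 0 ∨ n % 3 = 1 ∨ n % 3 = 2 := by omega
  rcases pow_three_eq_one_iff.mp hv with rfl | rfl | rfl <;>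
  rcases h3 with h3 | h3 | h3 <;> rw [h3] <;>
    simp [pow_two] at h <;> first | omega | simp [h1]

/-- Two distinct cube roots of unity congruent mod `π` would force `norm π ∣ 3`, so one verified
congruence pins down the value. -/
theorem cubicChar_eq {π α : EisensteinInt} (hπ : Prime π) (hN : norm π ≠ 3) {v : EisensteinInt}
    (hv : v ^ 3 = 1) (h : π ∣ α ^ ((norm π - 1) / 3).toNat - v)
    (hα : ¬ π ∣ α) : cubicChar π α = v := by
  have key : ∀ w : EisensteinInt, w ^ 3 = 1 →
      (Congr π (α ^ ((norm π - 1) / 3).toNat) w ↔ w = v) := by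
    intro w hw
    constructor
    · intro h'
      by_contra hne
      have h1 : π ∣ w - v := by
        have := dvd_sub h h'
        rwa [sub_sub_sub_cancel_left] at this
      have h2 := norm_dvd_of_dvd h1
      rw [norm_sub_of_pow_three hw hv hne] at h2
      have h3 : (norm π).natAbs ∣ 3 := by simpa using Int.natAbs_dvd_natAbs.mpr h2
      rcases (Nat.dvd_prime Nat.prime_three).mp h3 with h4 | h4
      · exact hπ.not_isUnit (isUnit_of_norm_eq_one (by have := norm_nonneg π; omega))
      · exact hN (by have := norm_nonneg π; omega)
    · rintro rfl
      exact h
  rw [cubicChar, if_neg hα, key 1 (by simp), key ω omega_pow_three,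
    key (ω ^ 2) (pow_three_eq_one_iff.mpr (by simp))]
  split_ifs with h1 h2 h3
  · exact h1
  · exact h2
  · exact h3
  · rcases pow_three_eq_one_iff.mp hv with h | h | h
    · exact absurd h.symm h1
    · exact absurd h.symm h2
    · exact absurd h.symm h3

/-! ### The cubic character of a finite field and its Jacobi sum. -/

section Character

open Finset

variable {F : Type*} [Field F] {k : ℕ} {φ : EisensteinInt →+* F}

theorem map_injOn_cubeRoots (h3 : (3 : F) ≠ 0) {v w : EisensteinInt}
    (hv : v ^ 3 = 1) (hw : w ^ 3 = 1) (h : φ v = φ w) : v = w := by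
  by_contra hne
  apply h3
  have h1 := congrArg φ (coe_norm (v - w))
  rw [norm_sub_of_pow_three hv hw hne, map_mul, map_sub, h, sub_self, zero_mul] at h1
  rwa [map_intCast, Int.cast_ofNat] at h1

theorem exists_cubeRoot_map_eq {y : F} (hy : y ^ 3 = 1) :
    ∃ v : EisensteinInt, v ^ 3 = 1 ∧ φ v = y := by
  have h0 : φ ω ^ 2 + φ ω + 1 = 0 := by simpa using congrArg φ omega_sq_add
  have h1 : (y - 1) * ((y - φ ω) * (y - φ ω ^ 2)) = 0 := by
    linear_combination hy + (y - 1) * (φ ω - 1 - y) * h0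
  rcases mul_eq_zero.mp h1 with h | h
  · exact ⟨1, by simp, by simp [sub_eq_zero.mp h]⟩
  · rcases mul_eq_zero.mp h with h | h
    · exact ⟨ω, omega_pow_three, (sub_eq_zero.mp h).symm⟩
    · exact ⟨ω ^ 2, pow_three_eq_one_iff.mpr (by simp), by rw [map_pow, sub_eq_zero.mp h]⟩

/-- A multiplicative character lifting `x ↦ x ^ k` along `φ`. -/
structure LiftsPow (φ : EisensteinInt →+* F) (k : ℕ) (χ : MulChar F EisensteinInt) : Prop where
  map_apply : ∀ x, φ (χ x) = x ^ k
  pow_three : ∀ x, x ≠ 0 → χ x ^ 3 = 1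

theorem LiftsPow.apply_neg_one {χ : MulChar F EisensteinInt} (h : LiftsPow φ k χ) : χ (-1) = 1 := by
  have h1 := h.pow_three (-1) (neg_ne_zero.mpr one_ne_zero)
  have h2 : χ (-1) ^ 2 = 1 := by rw [← map_pow]; simp
  linear_combination h1 - χ (-1) * h2

theorem LiftsPow.apply_pow_two_eq_inv {χ : MulChar F EisensteinInt} (h : LiftsPow φ k χ) (x : F) :
    χ x ^ 2 = χ⁻¹ x := by
  rcases eq_or_ne x 0 with rfl | hx
  · rw [MulChar.map_zero, MulChar.map_zero, zero_pow two_ne_zero]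
  · have h1 : χ x * χ⁻¹ x = 1 := by
      rw [← MulChar.mul_apply, mul_inv_cancel, MulChar.one_apply hx.isUnit]
    linear_combination -χ x ^ 2 * h1 + χ⁻¹ x * h.pow_three x hx

variable [Fintype F]

theorem three_mul_eq_neg_one (hk : Fintype.card F = 3 * k + 1) : (3 : F) * k = -1 := by
  have := Nat.cast_card_eq_zero F
  rw [hk] at this
  push_cast at this
  linear_combination this

theorem three_ne_zero_of_card (hk : Fintype.card F = 3 * k + 1) : (3 : F) ≠ 0 := by
  intro h
  have := three_mul_eq_neg_one hk
  rw [h, zero_mul, eq_comm, neg_eq_zero] at this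
  exact one_ne_zero this

theorem exponent_pos (hk : Fintype.card F = 3 * k + 1) : 0 < k := by
  have := Fintype.one_lt_card (α := F)
  omega

theorem pow_exponent_pow_three (hk : Fintype.card F = 3 * k + 1) {x : F} (hx : x ≠ 0) :
    (x ^ k) ^ 3 = 1 := by
  rw [← pow_mul, mul_comm, show 3 * k = Fintype.card F - 1 by omega]
  exact FiniteField.pow_card_sub_one_eq_one x hx

/-- Since `φ` is injective on cube roots of unity, the chosen lifts of `x ^ k` inherit
multiplicativity. -/
theorem exists_liftsPow (hk : Fintype.card F = 3 * k + 1) (φ : EisensteinInt →+* F) :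
    ∃ χ : MulChar F EisensteinInt, LiftsPow φ k χ := by
  classical
  have h3 := three_ne_zero_of_card hk
  choose c hc3 hc using fun x : Fˣ ↦
    exists_cubeRoot_map_eq (φ := φ) (pow_exponent_pow_three hk x.ne_zero)
  let f : Fˣ →* EisensteinInt :=
    { toFun := c
      map_one' := map_injOn_cubeRoots h3 (hc3 1) (one_pow 3) (by rw [hc]; simp)
      map_mul' := fun x y ↦ map_injOn_cubeRoots h3 (hc3 _)
        (by rw [mul_pow, hc3, hc3, one_mul]) (by rw [map_mul, hc, hc, hc]; simp [mul_pow]) }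
  have hf : ∀ x : Fˣ, MulChar.ofUnitHom f.toHomUnits (x : F) = c x := fun x ↦ by
    rw [MulChar.ofUnitHom_coe]; rfl
  refine ⟨MulChar.ofUnitHom f.toHomUnits, fun x ↦ ?_, fun x hx ↦ ?_⟩
  · rcases eq_or_ne x 0 with rfl | hx
    · rw [MulChar.map_zero, map_zero, zero_pow (exponent_pos hk).ne']
    · lift x to Fˣ using hx.isUnit
      rw [hf, hc]
  · lift x to Fˣ using hx.isUnit
    rw [hf, hc3]

namespace LiftsPow

variable {χ : MulChar F EisensteinInt}

theorem ne_one (hk : Fintype.card F = 3 * k + 1) (h : LiftsPow φ k χ) : χ ≠ 1 := by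
  classical
  rintro rfl
  have h1 : ∑ x : F, x ^ k = 0 :=
    FiniteField.sum_pow_lt_card_sub_one F k (by have := exponent_pos hk; omega)
  simp_rw [← h.map_apply, ← map_sum, MulChar.sum_one_eq_card_units, map_natCast,
    Fintype.card_units, hk] at h1
  have := three_mul_eq_neg_one hk
  push_cast [Nat.add_sub_cancel] at h1
  rw [this, neg_eq_zero] at h1
  exact one_ne_zero h1

theorem mul_self_ne_one (hk : Fintype.card F = 3 * k + 1) (h : LiftsPow φ k χ) :
    χ * χ ≠ 1 := by
  intro h1
  have h2 : χ⁻¹ = 1 := by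
    rw [← h1]
    refine MulChar.ext fun x ↦ ?_
    rw [MulChar.mul_apply, ← pow_two, h.apply_pow_two_eq_inv]
  exact h.ne_one hk (inv_eq_one.mp h2)

theorem one_add_apply_add_inv_apply [DecidableEq F] (hk : Fintype.card F = 3 * k + 1)
    (h : LiftsPow φ k χ) (x : F) :
    (1 : MulChar F EisensteinInt) x + χ x + χ⁻¹ x = if x ^ k = 1 then 3 else 0 := by
  rcases eq_or_ne x 0 with rfl | hx
  · simp [MulChar.map_zero, zero_pow (exponent_pos hk).ne']
  · have hχ := h.pow_three x hx
    have h1 : x ^ k = 1 ↔ χ x = 1 := by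
      rw [← h.map_apply]
      exact ⟨fun h' ↦ map_injOn_cubeRoots (three_ne_zero_of_card hk) hχ (one_pow 3)
        (by rw [h', map_one]), fun h' ↦ by rw [h', map_one]⟩
    rw [MulChar.one_apply hx.isUnit, ← h.apply_pow_two_eq_inv]
    split_ifs with h2
    · rw [h1.mp h2]; norm_num
    · have h3 : χ x - 1 ≠ 0 := sub_ne_zero.mpr fun h' ↦ h2 (h1.mpr h')
      apply mul_left_cancel₀ h3
      linear_combination hχ

/-- `1 + χ + χ⁻¹` is `3` times the indicator of `x ^ k = 1`. Weighting it by `χ(1 - x)` gives `J(1,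
χ) + J(χ, χ) + J(χ⁻¹, χ)`, whose outer terms are both `-1`. -/
theorem jacobiSum_eq (hk : Fintype.card F = 3 * k + 1) (h : LiftsPow φ k χ) {μ : F}
    (hμ : IsPrimitiveRoot μ k) :
    jacobiSum χ χ = 2 + 3 * ∑ j ∈ range (k - 1), χ (1 - μ ^ (j + 1)) := by
  classical
  have h1 : ∑ x : F, ((1 : MulChar F EisensteinInt) x + χ x + χ⁻¹ x) * χ (1 - x) =
      jacobiSum χ χ - 2 := by
    simp_rw [add_mul, sum_add_distrib]
    have e1 := jacobiSum_one_nontrivial (h.ne_one hk)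
    have e2 := jacobiSum_nontrivial_inv (h.ne_one hk)
    rw [jacobiSum_comm, h.apply_neg_one] at e2
    rw [jacobiSum] at e1 e2
    rw [e1, e2, jacobiSum]
    ring
  have h2 : ∑ j ∈ range k, χ (1 - μ ^ j) = ∑ x : F with x ^ k = 1, χ (1 - x) := by
    refine sum_bij (fun j _ ↦ μ ^ j) (fun j _ ↦ ?_) (fun i hi j hj hij ↦ ?_) (fun x hx ↦ ?_)
      (fun _ _ ↦ rfl)
    · rw [mem_filter, ← pow_mul, mul_comm, pow_mul, hμ.pow_eq_one, one_pow]
      exact ⟨mem_univ _, rfl⟩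
    · exact hμ.pow_inj (mem_range.mp hi) (mem_range.mp hj) hij
    · have := NeZero.of_pos (exponent_pos hk)
      obtain ⟨i, hi, rfl⟩ := hμ.eq_pow_of_pow_eq_one (mem_filter.mp hx).2
      exact ⟨i, mem_range.mpr hi, rfl⟩
  obtain ⟨l, rfl⟩ := Nat.exists_eq_add_one.mpr (exponent_pos hk)
  -- The root `μ ^ 0 = 1` contributes `χ 0 = 0`, leaving `k - 1` terms.
  rw [sum_range_succ', pow_zero, sub_self, MulChar.map_zero, add_zero] at h2
  rw [Nat.add_sub_cancel, h2, mul_sum, sum_filter, ← sub_eq_iff_eq_add', ← h1]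
  refine sum_congr rfl fun x _ ↦ ?_
  rw [h.one_add_apply_add_inv_apply hk]
  split_ifs <;> simp

theorem apply_exponent (hk : Fintype.card F = 3 * k + 1) (h : LiftsPow φ k χ) :
    χ (k : F) = χ 3 ^ 2 := by
  have h1 : χ 3 * χ (k : F) = 1 := by
    rw [← map_mul, three_mul_eq_neg_one hk, h.apply_neg_one]
  linear_combination χ 3 ^ 2 * h1 - χ (k : F) * h.pow_three 3 (three_ne_zero_of_card hk)

theorem exists_jacobiSum_eq (hk : Fintype.card F = 3 * k + 1) (h : LiftsPow φ k χ) :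
    ∃ S : EisensteinInt, jacobiSum χ χ = 2 + 3 * S ∧ 3 ∣ S - (k - 2) - χ 3 ^ 2 := by
  obtain ⟨g, hg⟩ := IsCyclic.exists_ofOrder_eq_natCard (α := Fˣ)
  have hg' : IsPrimitiveRoot (g : F) (3 * k) := by
    rw [IsPrimitiveRoot.coe_units_iff]
    have := IsPrimitiveRoot.orderOf g
    rwa [hg, Nat.card_units, Nat.card_eq_fintype_card, hk, Nat.add_sub_cancel] at this
  have hkpos := exponent_pos hk
  have hμ : IsPrimitiveRoot ((g : F) ^ 3) k := hg'.pow (by omega) rfl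
  refine ⟨_, h.jacobiSum_eq hk hμ, ?_⟩
  obtain ⟨l, rfl⟩ := Nat.exists_eq_add_one.mpr hkpos
  -- `χ 3 ^ 2 = χ k`, and `k` is the product of `1 - ζ` over the nontrivial `k`-th roots of unity.
  rw [Nat.add_sub_cancel, ← h.apply_exponent hk, Nat.cast_succ, Nat.cast_succ,
    ← hμ.prod_one_sub_pow_eq_order, map_prod]
  have h1 := three_dvd_sum_sub_prod (range l)
    (fun j ↦ χ (1 - ((g : F) ^ 3) ^ (j + 1))) fun j hj ↦ h.pow_three _ ?_
  · rw [card_range] at h1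
    convert h1 using 2
    ring
  · rw [sub_ne_zero]
    exact (hμ.pow_ne_one_of_pos_of_lt (Nat.succ_ne_zero j)
      (by have := mem_range.mp hj; omega)).symm

theorem norm_jacobiSum (hk : Fintype.card F = 3 * k + 1) (h : LiftsPow φ k χ) :
    norm (jacobiSum χ χ) = Fintype.card F := by
  -- The product formula for `J(χ, χ) J(χ⁻¹, χ⁻¹)` is applied with values in a field; conjugation
  -- turns `χ` into `χ⁻¹`.
  let K := FractionRing EisensteinInt
  let f : EisensteinInt →+* K := algebraMap EisensteinInt K
  have hf : Function.Injective f := IsFractionRing.injective EisensteinInt K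
  have : CharZero K := charZero_of_injective_algebraMap hf
  have hstar : χ⁻¹ = χ.ringHomComp (starRingEnd EisensteinInt) := by
    refine MulChar.ext fun x ↦ ?_
    have hx := h.pow_three x x.ne_zero
    rw [← h.apply_pow_two_eq_inv, MulChar.ringHomComp_apply, starRingEnd_apply]
    linear_combination star (χ x) * hx - χ x ^ 2 * mul_star_of_pow_three hx
  have hchar : ringChar K ≠ ringChar F := by
    rw [ringChar.eq_zero]
    exact (CharP.ringChar_ne_zero_of_finite F).symm
  have h1 := jacobiSum_mul_jacobiSum_inv hchar
    ((MulChar.ringHomComp_ne_one_iff hf).mpr (h.ne_one hk))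
    ((MulChar.ringHomComp_ne_one_iff hf).mpr (h.ne_one hk))
    (by rw [← MulChar.ringHomComp_mul]
        exact (MulChar.ringHomComp_ne_one_iff hf).mpr (h.mul_self_ne_one hk))
  rw [MulChar.ringHomComp_inv, jacobiSum_ringHomComp, jacobiSum_ringHomComp, hstar,
    jacobiSum_ringHomComp, ← map_mul, starRingEnd_apply, ← coe_norm, map_intCast] at h1
  exact_mod_cast h1

/-- The image is `∑ x^k (1 - x)^k`, a polynomial of degree `2k < 3k = |F| - 1`, so every power sum
vanishes. -/
theorem map_jacobiSum (hk : Fintype.card F = 3 * k + 1) (h : LiftsPow φ k χ) :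
    φ (jacobiSum χ χ) = 0 := by
  simp_rw [jacobiSum, map_sum, map_mul, h.map_apply, sub_eq_neg_add, add_pow, mul_sum]
  rw [sum_comm]
  refine sum_eq_zero fun i hi ↦ ?_
  have h1 : ∀ x : F, x ^ k * ((-x) ^ i * 1 ^ (k - i) * (k.choose i : F)) =
      (-1) ^ i * (k.choose i : F) * x ^ (k + i) := fun x ↦ by
    rw [neg_pow]; ring
  simp_rw [h1, ← mul_sum]
  rw [FiniteField.sum_pow_lt_card_sub_one F, mul_zero]
  have := mem_range.mp hi
  have := exponent_pos hk
  omega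

end LiftsPow

end Character

/-! ### Rational primes. -/

theorem norm_one_sub_omega : norm (1 - ω) = 3 := by simp [norm]

theorem not_dvd_one_sub_omega {π : EisensteinInt} (hπ : Prime π) (hN : norm π ≠ 3) :
    ¬ π ∣ 1 - ω := by
  intro h
  have h2 := norm_dvd_of_dvd h
  rw [norm_one_sub_omega] at h2
  have h3 : (norm π).natAbs ∣ 3 := by simpa using Int.natAbs_dvd_natAbs.mpr h2
  have h0 := norm_nonneg π
  rcases (Nat.dvd_prime Nat.prime_three).mp h3 with h4 | h4
  · exact hπ.not_isUnit (isUnit_of_norm_eq_one (by omega))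
  · exact hN (by omega)

/-- A rational prime not congruent to `2` modulo `3` divides some `z ^ 2 + z + 1`. -/
theorem exists_dvd_sq_add_add_one {q : ℕ} (hq : q.Prime) (h : q % 3 ≠ 2) :
    ∃ z : ℤ, (q : ℤ) ∣ z ^ 2 + z + 1 := by
  rcases eq_or_ne q 3 with rfl | h3
  · exact ⟨1, by norm_num⟩
  have := Fact.mk hq
  have hq1 : q % 3 = 1 := by
    have : q % 3 ≠ 0 := fun h0 ↦
      h3 ((Nat.prime_dvd_prime_iff_eq Nat.prime_three hq).mp (Nat.dvd_of_mod_eq_zero h0)).symm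
    omega
  have hdvd : 3 ∣ Fintype.card (ZMod q)ˣ := by
    rw [ZMod.card_units]; omega
  have := Fact.mk Nat.prime_three
  obtain ⟨g, hg⟩ := exists_prime_orderOf_dvd_card 3 hdvd
  have hg3 : (g : ZMod q) ^ 3 = 1 := by
    rw [← Units.val_pow_eq_pow_val, ← hg, pow_orderOf_eq_one, Units.val_one]
  have hg1 : (g : ZMod q) - 1 ≠ 0 := by
    rw [sub_ne_zero]
    intro h1
    rw [Units.val_eq_one] at h1
    rw [h1, orderOf_one] at hg
    omega
  obtain ⟨z, hz⟩ := ZMod.intCast_surjective (g : ZMod q)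
  refine ⟨z, (ZMod.intCast_zmod_eq_zero_iff_dvd _ q).mp ?_⟩
  push_cast
  rw [hz]
  apply mul_left_cancel₀ hg1
  linear_combination hg3

/-- Otherwise `q` divides some `z^2 + z + 1 = (z - ω)(z - ω^2)` but neither factor, whose
`ω`-coefficients are `±1`. -/
theorem mod_three_of_prime_natCast {q : ℕ} (hq : q.Prime) (hπ : Prime (q : EisensteinInt)) :
    q % 3 = 2 := by
  by_contra h
  obtain ⟨z, hz⟩ := exists_dvd_sq_add_add_one hq h
  have h1 : ((q : ℤ) : EisensteinInt) ∣ ((z ^ 2 + z + 1 : ℤ) : EisensteinInt) :=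
    (Int.castRingHom EisensteinInt).map_dvd hz
  have h2 : ((z ^ 2 + z + 1 : ℤ) : EisensteinInt) = (z - ω) * (z - ω ^ 2) := by
    push_cast
    linear_combination (z - ω + 1) * omega_sq_add
  have hq2 := hq.two_le
  rw [h2, Int.cast_natCast] at h1
  rcases hπ.dvd_or_dvd h1 with h3 | h3 <;>
  · rw [← Int.cast_natCast, intCast_dvd_iff] at h3
    have := Int.le_of_dvd one_pos (by simpa [pow_two] using h3.2)
    omega

theorem cubicChar_natCast {q : ℕ} {m : ℤ} (hq : q.Prime) (hπ : Prime (q : EisensteinInt))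
    (hN : norm (q : EisensteinInt) ≠ 3) (hm : (q : ℤ) = 3 * m - 1) :
    cubicChar q (1 - ω) = ((ωUnit ^ (2 * m) : EisensteinIntˣ) : EisensteinInt) := by
  have hq2 := hq.two_le
  obtain ⟨M, rfl⟩ := Int.eq_ofNat_of_zero_le (show 0 ≤ m by omega)
  have hdvd := not_dvd_one_sub_omega hπ hN
  refine cubicChar_eq hπ hN (omegaUnit_zpow_pow_three _) ?_ hdvd
  have hexp : ((norm (q : EisensteinInt) - 1) / 3).toNat = (q - 1) * M := by
    rw [norm_natCast, show ((q : ℤ) ^ 2 - 1) = ((q - 1 : ℕ) * M : ℕ) * 3 by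
      push_cast [Nat.cast_sub hq.one_le]; linear_combination ((q : ℤ) - 1) * hm,
      Int.mul_ediv_cancel _ (by norm_num), Int.toNat_natCast]
  have hω : ω ^ q = ω ^ 2 := by
    rw [show q = 3 * (M - 1) + 2 by omega, pow_add, pow_mul, omega_pow_three, one_pow, one_mul]
  have h1 : (q : EisensteinInt) ∣ (1 - ω) ^ (q - 1) - (-ω ^ 2) := by
    obtain ⟨r, hr⟩ := exists_add_pow_prime_eq hq (1 - ω) ω
    rw [sub_add_cancel, one_pow, hω] at hr
    refine (hπ.dvd_or_dvd (a := 1 - ω) ⟨-(1 - ω) * ω * r, ?_⟩).resolve_left hdvd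
    have hs : (1 - ω) * (1 - ω) ^ (q - 1) = (1 - ω) ^ q := mul_pow_sub_one (by omega) _
    linear_combination hs - hr - omega_pow_three
  have h2 := h1.trans (sub_dvd_pow_sub_pow _ _ M)
  rw [← pow_mul, ← hexp, neg_pow] at h2
  have h3 : ((ωUnit ^ (2 * (M : ℤ)) : EisensteinIntˣ) : EisensteinInt) = (ω ^ 2) ^ M := by
    rw [← pow_mul, show 2 * (M : ℤ) = ((2 * M : ℕ) : ℤ) by push_cast; rfl, zpow_natCast,
      Units.val_pow_eq_pow_val]
    rfl
  rw [h3]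
  rcases hq.eq_two_or_odd with rfl | hodd
  -- For `q = 2` the exponent `M` is odd, but the sign disappears mod `2`.
  · obtain rfl : M = 1 := by omega
    convert dvd_sub h2 (dvd_mul_right ((2 : ℕ) : EisensteinInt) (ω ^ 2)) using 1
    push_cast
    ring
  · rwa [Even.neg_one_pow (by rw [Nat.even_iff]; omega), one_mul] at h2

/-! ### Primary non-rational primes. -/

theorem exists_prime_dvd_natCast {π : EisensteinInt} (hπ : Prime π) :
    ∃ q : ℕ, q.Prime ∧ π ∣ q := by
  have h1 : π ∣ ((norm π).natAbs : EisensteinInt) := by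
    rw [← Int.cast_natCast, Int.natAbs_of_nonneg (norm_nonneg π), coe_norm]
    exact dvd_mul_right _ _
  have h0 : (norm π).natAbs ≠ 0 := fun h ↦ hπ.ne_zero (norm_eq_zero (Int.natAbs_eq_zero.mp h))
  rw [← Nat.prod_primeFactorsList h0, ← Nat.coe_castRingHom, map_list_prod,
    hπ.dvd_prod_iff] at h1
  obtain ⟨_, h2, h3⟩ := h1
  obtain ⟨q, hq, rfl⟩ := List.mem_map.mp h2
  exact ⟨q, Nat.prime_of_mem_primeFactorsList hq, h3⟩

/-- The only units `c + d ω` with `3 ∣ d` are `±1`. -/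
theorem im_eq_zero_of_norm_eq_one {α : EisensteinInt} (h : norm α = 1) (h3 : 3 ∣ α.im) :
    α.im = 0 := by
  have h4 := four_mul_norm α
  rw [h] at h4
  obtain ⟨d, hd⟩ := h3
  rw [hd] at h4 ⊢
  have : d ^ 2 < 1 := by nlinarith [sq_nonneg (2 * α.re - 3 * d)]
  have := sq_lt_one_iff_abs_lt_one d |>.mp this
  rw [Int.abs_lt_one_iff.mp this, mul_zero]

/-- The norm divides `q^2` for a rational prime `q`. Norm `q^2` would make `π` a unit times `q`;
being primary forces the unit to be `±1`, so `π` would be rational. -/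
theorem exists_prime_norm_eq {π : EisensteinInt} (hπ : Prime π) (hre : π.re % 3 = 2)
    (him3 : 3 ∣ π.im) (him : π.im ≠ 0) : ∃ p : ℕ, p.Prime ∧ norm π = p := by
  obtain ⟨q, hq, hdvd⟩ := exists_prime_dvd_natCast hπ
  have h1 := norm_dvd_of_dvd hdvd
  rw [norm_natCast] at h1
  have h0 := norm_nonneg π
  have h2 : (norm π).natAbs ∣ q ^ 2 := by
    simpa [Int.natAbs_pow] using Int.natAbs_dvd_natAbs.mpr h1
  obtain ⟨i, hi, h3⟩ := (Nat.dvd_prime_pow hq).mp h2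
  interval_cases i
  · exact absurd (isUnit_of_norm_eq_one (by rw [pow_zero] at h3; omega)) hπ.not_isUnit
  · exact ⟨q, hq, by rw [pow_one] at h3; omega⟩
  · exfalso
    have hq0 : (q : ℤ) ^ 2 ≠ 0 := pow_ne_zero 2 (by exact_mod_cast hq.ne_zero)
    have h4 : norm π = (q : ℤ) ^ 2 := by
      rw [← Int.natAbs_of_nonneg h0, h3]; push_cast; rfl
    obtain ⟨β, hβ⟩ := hdvd
    have h5 : norm β = 1 := by
      have := congrArg norm hβ
      rw [norm_mul, norm_natCast, h4] at this
      exact (mul_left_cancel₀ hq0 (by rw [← this, mul_one])).symm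
    have h6 : π = ((q : ℤ) : EisensteinInt) * star β := by
      have := coe_norm β
      rw [h5, Int.cast_one] at this
      rw [Int.cast_natCast, hβ, mul_assoc, ← this, mul_one]
    have h7 : norm (star β) = 1 := by
      have := congrArg norm h6
      rw [norm_mul, Int.cast_natCast, norm_natCast, h4] at this
      exact (mul_left_cancel₀ hq0 (by rw [← this, mul_one])).symm
    have hr : π.re = q * (star β).re := by rw [h6]; simp
    have hi : π.im = q * (star β).im := by rw [h6]; simp
    have h8 : (3 : ℤ) ∣ (star β).im := by
      rw [hi] at him3
      refine (Int.prime_three.dvd_or_dvd him3).resolve_left fun h ↦ ?_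
      have := h.mul_right (star β).re
      rw [← hr] at this
      omega
    exact him (by rw [hi, im_eq_zero_of_norm_eq_one h7 h8, mul_zero])

/-- Reduction modulo a prime of prime norm `p`, with values in `ZMod p`. -/
theorem exists_ringHom_zmod {π : EisensteinInt} {p : ℕ} (hp : p.Prime) (hN : norm π = p) :
    ∃ φ : EisensteinInt →+* ZMod p, ∀ x, φ x = 0 ↔ π ∣ x := by
  have := Fact.mk hp
  have hN' : (π.re : ZMod p) ^ 2 - π.re * π.im + π.im ^ 2 = 0 := by
    have := congrArg (Int.cast : ℤ → ZMod p) hN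
    simpa [norm] using this
  have hb : (π.im : ZMod p) ≠ 0 := by
    intro h
    have ha : (π.re : ZMod p) = 0 := by simpa [h] using hN'
    rw [ZMod.intCast_zmod_eq_zero_iff_dvd] at h ha
    obtain ⟨c, hc⟩ := ha
    obtain ⟨d, hd⟩ := h
    rw [norm, hc, hd] at hN
    have hp0 : (p : ℤ) ≠ 0 := by exact_mod_cast hp.ne_zero
    have h1 : (p : ℤ) ∣ 1 := ⟨c ^ 2 - c * d + d ^ 2,
      mul_left_cancel₀ hp0 (by linear_combination -hN)⟩
    exact hp.one_lt.ne' (by exact_mod_cast Int.eq_one_of_dvd_one (by positivity) h1)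
  -- The image of `ω` must be the root `-a/b` of `a + bω`.
  obtain ⟨u, hu⟩ : ∃ u : ZMod p, u * π.im = -π.re := ⟨_, div_mul_cancel₀ _ hb⟩
  have hu2 : u * u = (-1 : ℤ) • (1 : ZMod p) + (-1 : ℤ) • u := by
    apply mul_right_cancel₀ (pow_ne_zero 2 hb)
    simp only [neg_smul, one_smul]
    linear_combination (u * π.im + π.im - π.re) * hu + hN'
  let φ := QuadraticAlgebra.lift (R := ℤ) (A := ZMod p) ⟨u, hu2⟩
  have hφ : ∀ x, φ x = x.re + x.im * u := fun x ↦ by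
    simp [φ, QuadraticAlgebra.lift]
  refine ⟨φ, fun x ↦ ?_⟩
  rw [AlgHom.coe_toRingHom, hφ]
  constructor
  · intro h
    have e1 : (x.im * π.re - x.re * π.im : ZMod p) = 0 := by
      linear_combination x.im * hu - π.im * h
    have e2 : (x.re * π.re - x.re * π.im + x.im * π.im : ZMod p) = 0 := by
      apply mul_left_cancel₀ hb
      linear_combination x.im * hN' + (π.im - π.re) * e1
    have h1 : ((norm π : ℤ) : EisensteinInt) ∣ x * star π := by
      rw [hN, intCast_dvd_iff]
      simp only [← ZMod.intCast_zmod_eq_zero_iff_dvd]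
      constructor
      · simp; linear_combination e2
      · simp; linear_combination e1
    rw [coe_norm] at h1
    have hs : star π ≠ 0 := fun h ↦ hb (by
      have := congrArg QuadraticAlgebra.im h
      simp at this
      simp [this])
    exact (mul_dvd_mul_iff_right hs).mp h1
  · rintro ⟨y, rfl⟩
    rw [← hφ, map_mul, hφ π]
    linear_combination φ y * hu

theorem isPrimary_iff {π : EisensteinInt} :
    IsPrimary π ↔ Prime π ∧ π.re % 3 = 2 ∧ 3 ∣ π.im := by
  rw [IsPrimary, Congr, three_dvd_iff]
  refine and_congr_right fun _ ↦ and_congr ?_ ?_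
  · simp; omega
  · simp

/-- The quotient is a unit, congruent to `1` mod `3` because `2` is invertible there; only `1`
qualifies. -/
theorem eq_of_dvd_of_norm_eq {π J : EisensteinInt} (hN : norm J = norm π) (hπ : norm π ≠ 0)
    (h : π ∣ J) (h2 : 3 ∣ π - 2) (hJ : 3 ∣ J - 2) : J = π := by
  obtain ⟨β, rfl⟩ := h
  have h1 : norm β = 1 := by
    rw [norm_mul] at hN
    exact mul_left_cancel₀ hπ (by rw [hN, mul_one])
  have h3 : (3 : EisensteinInt) ∣ β - 1 := by
    have h4 : β - 1 = 2 * ((π * β - 2) - (π - 2) * β) - 3 * (β - 1) := by ring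
    rw [h4]
    exact dvd_sub (((hJ.sub (h2.mul_right β))).mul_left 2) (dvd_mul_right 3 _)
  rw [three_dvd_iff] at h3
  simp at h3
  have h5 := im_eq_zero_of_norm_eq_one h1 h3.2
  rw [norm, h5] at h1
  have h6 : β.re ^ 2 = 1 := by simpa using h1
  have h7 : β = 1 := by
    rcases mul_self_eq_one_iff.mp ((pow_two _).symm.trans h6) with h | h
    · exact QuadraticAlgebra.ext h h5
    · omega
  rw [h7, mul_one]

theorem cubicChar_of_isPrimary {π : EisensteinInt} {m : ℤ} (h : IsPrimary π)
    (hN : norm π ≠ 3) (him : π.im ≠ 0) (hm : π.re = 3 * m - 1) :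
    cubicChar π (1 - ω) = ((ωUnit ^ (2 * m) : EisensteinIntˣ) : EisensteinInt) := by
  obtain ⟨hπ, hre, n, hn⟩ := isPrimary_iff.mp h
  obtain ⟨p, hp, hNp⟩ := exists_prime_norm_eq hπ hre ⟨n, hn⟩ him
  obtain ⟨φ, hφ⟩ := exists_ringHom_zmod hp hNp
  have := Fact.mk hp
  have hp3 : (p : ℤ) = 3 * (3 * (m ^ 2 - m * n + n ^ 2 - m) + m + n) + 1 := by
    rw [← hNp, norm, hm, hn]; ring
  obtain ⟨k, hk'⟩ := Int.eq_ofNat_of_zero_le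
    (show 0 ≤ 3 * (m ^ 2 - m * n + n ^ 2 - m) + m + n by have := hp.one_lt; omega)
  rw [hk'] at hp3
  have hk : Fintype.card (ZMod p) = 3 * k + 1 := by rw [ZMod.card]; exact_mod_cast hp3
  obtain ⟨χ, hχ⟩ := exists_liftsPow hk φ
  obtain ⟨S, hS, h3S⟩ := hχ.exists_jacobiSum_eq hk
  have hJ : jacobiSum χ χ = π :=
    eq_of_dvd_of_norm_eq (by rw [hχ.norm_jacobiSum hk, ZMod.card, hNp])
      (by rw [hNp]; exact_mod_cast hp.ne_zero) ((hφ _).mp (hχ.map_jacobiSum hk)) h.2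
      ⟨S, by rw [hS]; ring⟩
  rw [hJ] at hS
  have hSre : S.re = m - 1 := by
    have := congrArg QuadraticAlgebra.re hS
    simp at this
    omega
  have hSim : S.im = n := by
    have := congrArg QuadraticAlgebra.im hS
    simp at this
    omega
  have h3 : (3 : ZMod p) ≠ 0 := three_ne_zero_of_card hk
  -- `S - (k - 2) = (m + 1 - k) + nω`, which is `(1 - n) + nω` mod `3` since `k ≡ m + n`.
  have hχ3 : χ 3 ^ 2 = ((ωUnit ^ n : EisensteinIntˣ) : EisensteinInt) := by
    refine omegaUnit_zpow_eq (by rw [← pow_mul, mul_comm, pow_mul, hχ.pow_three 3 h3, one_pow]) ?_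
    rw [three_dvd_iff] at h3S ⊢
    simp at h3S ⊢
    omega
  have hdvd := not_dvd_one_sub_omega hπ hN
  refine cubicChar_eq hπ hN (omegaUnit_zpow_pow_three _) ?_ hdvd
  have hexp : ((norm π - 1) / 3).toNat = k := by omega
  rw [hexp, ← hφ, map_sub, sub_eq_zero, map_pow]
  have hcube := pow_exponent_pow_three hk (x := φ (1 - ω)) (mt (hφ _).mp hdvd)
  have hfour : φ (1 - ω) ^ 4 = 3 ^ 2 * φ ω ^ 2 := by
    rw [← map_pow, show (1 - ω) ^ 4 = 3 ^ 2 * ω ^ 2 by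
      linear_combination (ω ^ 2 - 5 * ω + 1) * omega_sq_add]
    rw [map_mul, map_pow, map_pow, map_ofNat]
  -- A cube root of unity equals its fourth power, which brings in `(1 - ω)^4 = 9ω^2`.
  calc φ (1 - ω) ^ k = (φ (1 - ω) ^ 4) ^ k := by linear_combination -φ (1 - ω) ^ k * hcube
    _ = φ (χ 3 ^ 2 * ω ^ (2 * k)) := by
      rw [hfour, map_mul, map_pow, hχ.map_apply, map_pow, mul_pow, ← pow_mul, ← pow_mul, ← pow_mul,
        mul_comm k 2]
    _ = φ ((ωUnit ^ (2 * m) : EisensteinIntˣ) : EisensteinInt) := by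
      congr 1
      -- Exponents mod `3`: `n + 2k ≡ 2m + 3n ≡ 2m`.
      rw [hχ3, show ω ^ (2 * k) = ((ωUnit ^ ((2 * k : ℕ) : ℤ) : EisensteinIntˣ) : EisensteinInt) by
        rw [zpow_natCast, Units.val_pow_eq_pow_val]; rfl, ← Units.val_mul, ← zpow_add,
        omegaUnit_zpow_emod, omegaUnit_zpow_emod (2 * m)]
      congr 2
      omega

end EisensteinInt

theorem mainTheorem2 (π : EisensteinInt) (hπ : Prime π) (hN : EisensteinInt.norm π ≠ 3) :
    -- the rational case: `π = q` is a rational prime, written `q = 3 m - 1`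
    (∀ q : ℕ, q.Prime → π = (q : EisensteinInt) →
      (∃ m : ℤ, (q : ℤ) = 3 * m - 1) ∧
      ∀ m : ℤ, (q : ℤ) = 3 * m - 1 →
        EisensteinInt.cubicChar π (1 - EisensteinInt.ω) =
          ((EisensteinInt.ωUnit ^ (2 * m) : EisensteinIntˣ) : EisensteinInt)) ∧
    -- the non-rational case: `π = a + b ω` is primary with `b ≠ 0`, and `a = 3 m - 1`
    (EisensteinInt.IsPrimary π → π.im ≠ 0 →
      (∃ m : ℤ, π.re = 3 * m - 1) ∧
      ∀ m : ℤ, π.re = 3 * m - 1 →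
        EisensteinInt.cubicChar π (1 - EisensteinInt.ω) =
          ((EisensteinInt.ωUnit ^ (2 * m) : EisensteinIntˣ) : EisensteinInt)) := by
  refine ⟨?_, fun h him ↦ ⟨?_, fun m hm ↦ EisensteinInt.cubicChar_of_isPrimary h hN him hm⟩⟩
  · rintro q hq rfl
    have := EisensteinInt.mod_three_of_prime_natCast hq hπ
    exact ⟨⟨(q + 1) / 3, by omega⟩, fun m hm ↦ EisensteinInt.cubicChar_natCast hq hπ hN hm⟩
  · have := (EisensteinInt.isPrimary_iff.mp h).2.1
    exact ⟨(π.re + 1) / 3, by omega⟩
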